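/- Let $r,\rho\in(0,\infty)$ satisfy $r<1<\rho$ and, for all integers $k,\ell$, $r^k=\rho^\ell$ if and only if $k=\ell=0$. Let $$M_{r,\rho}=\{(x_1,x_2,\dots)\in[0,1]^{\mathbb N} : x_{i+1}\in\{r x_i,\rho x_i\}\text{ for all } i\},$$ with the product topology, let $\sigma_{r,\rho}:M_{r,\rho}\to M_{r,\rho}$ be the shift map $(x_1,x_2,x_3,\dots)\mapsto(x_2,x_3,\dots)$, let $$M=\varprojlim(M_{r,\rho},\sigma_{r,\rho})=\{(\mathbf x_1,\mathbf x_2,\dots)\in M_{r,\rho}^{\mathbb N} : \mathbf x_i=\sigma_{r,\rho}(\mathbf x_{i+1})\text{ for all } i\},$$ and let $\sigma:M\to M$ be the shift map $(\mathbf x_1,\mathbf x_2,\mathbf x_3,\dots)\mapsto(\mathbf x_2,\mathbf x_3,\dots)$. Then $M$ is a Lelek fan, and $\sigma$ is a homeomorphism of $M$ onto itself that is transitive, i.e. for all non-empty open $U,V\subseteq M$ there is $n\ge 0$ with $\sigma^n(U)\cap V\ne\emptyset$. Here a continuum is a non-empty compact connected metrizable space; a dendroid is an arcwise connected continuum $X$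 that is hereditarily unicoherent (whenever a subcontinuum of $X$ is the union of two subcontinua, the intersection of these two is connected). A ramification point of $X$ is the top (the branch point) of a simple triod contained in $X$, and an end-point of $X$ is a point that is an end-point of every arc in $X$ containing it. A fan is a dendroid with at most one ramification point; this point, if it exists, is the top of the fan. A fan $X$ with top $v$ is smooth if $x_n\to x$ in $X$ implies $A[v,x_n]\to A[v,x]$ in the Hausdorff metric, where $A[v,x]$ is the arc in $X$ with end-points $v$ and $x$ if $x\ne v$, and $A[v,v]=\{v\}$. A Lelek fan is a smooth fan whose set of end-points is dense. -/

import Mathlib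

open Set Topology Filter
open scoped unitInterval

namespace LelekFan

/-! ### Continua, arcs, dendroids and fans -/

section Continua

variable {X : Type*} [TopologicalSpace X]

/-- The space `X` is a continuum: a non-empty compact connected metrizable space. -/
def IsContinuum (X : Type*) [TopologicalSpace X] : Prop :=
  CompactSpace X ∧ ConnectedSpace X ∧ TopologicalSpace.MetrizableSpace X

/-- The subset `Y` of `X` is, with the subspace topology, a continuum. -/
def IsSubcontinuum (Y : Set X) : Prop :=
  IsContinuum Y

/-- The set `Y` is unicoherent: whenever it is the union of two subcontinua, their intersection
is connected. -/
def IsUnicoherent (Y : Set X) : Prop :=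
  ∀ A B : Set X, IsSubcontinuum A → IsSubcontinuum B → A ∪ B = Y → IsConnected (A ∩ B)

/-- Every subcontinuum of `X` is unicoherent. -/
def HereditarilyUnicoherent (X : Type*) [TopologicalSpace X] : Prop :=
  ∀ Y : Set X, IsSubcontinuum Y → IsUnicoherent Y

/-- `A` is an arc, i.e. homeomorphic to `[0,1]`. -/
def IsArc (A : Set X) : Prop :=
  Nonempty (I ≃ₜ A)

/-- `A` is an arc with end-points `x` and `y`. -/
def IsArcBetween (A : Set X) (x y : X) : Prop :=
  ∃ φ : I ≃ₜ A, (φ 0 : X) = x ∧ (φ 1 : X) = y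

/-- `x` is an end-point of the arc `A`. -/
def IsEndPointOfArc (A : Set X) (x : X) : Prop :=
  ∃ φ : I ≃ₜ A, (φ 0 : X) = x

/-- Any two distinct points of `X` are the end-points of an arc in `X`. -/
def ArcwiseConnected (X : Type*) [TopologicalSpace X] : Prop :=
  ∀ x y : X, x ≠ y → ∃ A : Set X, IsArcBetween A x y

/-- A dendroid is an arcwise connected hereditarily unicoherent continuum. -/
def IsDendroid (X : Type*) [TopologicalSpace X] : Prop :=
  IsContinuum X ∧ ArcwiseConnected X ∧ HereditarilyUnicoherent X

/-- The set `E(X)` of the points that are an end-point of every arc in `X` containing them. -/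
def endPoints (X : Type*) [TopologicalSpace X] : Set X :=
  {x | ∀ A : Set X, IsArc A → x ∈ A → IsEndPointOfArc A x}

/-- The model simple triod `([-1,1] × {0}) ∪ ({0} × [0,1])` in the plane. -/
def triod : Set (ℝ × ℝ) :=
  Icc (-1) 1 ×ˢ {0} ∪ {0} ×ˢ Icc 0 1

/-- `T` is a simple triod with top `x`. -/
def IsSimpleTriodWithTop (T : Set X) (x : X) : Prop :=
  ∃ φ : triod ≃ₜ T, ∃ o : triod, (o : ℝ × ℝ) = (0, 0) ∧ (φ o : X) = x

/-- The set `R(X)` of the tops of the simple triods in `X`. -/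
def ramificationPoints (X : Type*) [TopologicalSpace X] : Set X :=
  {x | ∃ T : Set X, IsSimpleTriodWithTop T x}

/-- A fan is a dendroid with at most one ramification point. -/
def IsFan (X : Type*) [TopologicalSpace X] : Prop :=
  IsDendroid X ∧ (ramificationPoints X).Subsingleton

/-- `A` is the set `A[x,y]`: the arc with end-points `x` and `y` if `x ≠ y`, and `{x}` if `x = y`.
In a dendroid there is exactly one such set for any `x` and `y`. -/
def IsSegment (A : Set X) (x y : X) : Prop :=
  (x ≠ y ∧ IsArcBetween A x y) ∨ (x = y ∧ A = {x})

/-- A fan with top `v` is smooth if `A[v, xₙ]` converges to `A[v, x]` whenever `xₙ` converges to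
`x`. The topology on the type of non-empty compact subsets is the Vietoris topology; it is
the topology of the Hausdorff metric for each metric inducing the topology of `X`. -/
def IsSmoothFan (X : Type*) [TopologicalSpace X] : Prop :=
  IsFan X ∧ ∃ v ∈ ramificationPoints X,
    ∀ (x : X) (u : ℕ → X), Tendsto u atTop (𝓝 x) →
      ∀ (A : TopologicalSpace.NonemptyCompacts X) (B : ℕ → TopologicalSpace.NonemptyCompacts X),
        IsSegment (A : Set X) v x → (∀ n, IsSegment (B n : Set X) v (u n)) →
          Tendsto B atTop (𝓝 A)

/-- A Lelek fan is a smooth fan whose set of end-points is dense. -/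
def IsLelekFan (X : Type*) [TopologicalSpace X] : Prop :=
  IsSmoothFan X ∧ Dense (endPoints X)

end Continua

/-! ### Transitivity, Mahavier products and inverse limits -/

/-- The map `f` is transitive: for all non-empty open `U` and `V` there is `n ≥ 0` such that
`fⁿ(U)` meets `V`. -/
def IsTransitiveMap {X : Type*} [TopologicalSpace X] (f : X → X) : Prop :=
  ∀ U V : Set X, IsOpen U → IsOpen V → U.Nonempty → V.Nonempty →
    ∃ n : ℕ, ((f^[n] '' U) ∩ V).Nonempty

/-- The infinite Mahavier product of a relation `G` on `X`, indexed from `0`. -/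
def mahavierProduct {X : Type*} (G : Set (X × X)) : Set (ℕ → X) :=
  {x | ∀ i, (x i, x (i + 1)) ∈ G}

/-- The shift map `(x₀, x₁, x₂, …) ↦ (x₁, x₂, …)` on the Mahavier product. -/
def mahavierShift {X : Type*} (G : Set (X × X)) : mahavierProduct G → mahavierProduct G :=
  fun x => ⟨fun i => x.1 (i + 1), fun i => x.2 (i + 1)⟩

/-- The inverse limit of `X` with the single bonding map `f`, indexed from `0`. -/
def inverseLimit {X : Type*} (f : X → X) : Set (ℕ → X) :=
  {x | ∀ i, x i = f (x (i + 1))}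

/-- The shift map `(x₀, x₁, x₂, …) ↦ (x₁, x₂, …)` on the inverse limit. -/
def inverseLimitShift {X : Type*} (f : X → X) : inverseLimit f → inverseLimit f :=
  fun x => ⟨fun i => x.1 (i + 1), fun i => x.2 (i + 1)⟩

/-! ### The spaces `M_{r,ρ}` and `M` -/

/-- The numbers `r` and `ρ` never connect. -/
def NeverConnect (r ρ : ℝ) : Prop :=
  0 < r ∧ 0 < ρ ∧ r < 1 ∧ 1 < ρ ∧ ∀ k l : ℤ, r ^ k = ρ ^ l ↔ k = 0 ∧ l = 0

/-- The line segment `L_r = {(x, y) ∈ [0,1] × [0,1] | y = r x}`. -/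
def segmentRel (r : ℝ) : Set (I × I) :=
  {p | (p.2 : ℝ) = r * (p.1 : ℝ)}

/-- The closed relation `L_{r,ρ} = L_r ∪ L_ρ` on `[0,1]`. -/
def relL (r ρ : ℝ) : Set (I × I) :=
  segmentRel r ∪ segmentRel ρ

/-- The Mahavier product `M_{r,ρ}`, a subspace of the Hilbert cube. -/
abbrev MSpace (r ρ : ℝ) : Type :=
  mahavierProduct (relL r ρ)

/-- The shift map `σ_{r,ρ}` on `M_{r,ρ}`. -/
def sigmaM (r ρ : ℝ) : MSpace r ρ → MSpace r ρ :=
  mahavierShift (relL r ρ)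

/-- The inverse limit `M` of `M_{r,ρ}` under `σ_{r,ρ}`. -/
abbrev MLim (r ρ : ℝ) : Type :=
  inverseLimit (sigmaM r ρ)

/-- The shift map `σ` on `M`. -/
def sigmaLim (r ρ : ℝ) : MLim r ρ → MLim r ρ :=
  inverseLimitShift (sigmaM r ρ)

end LelekFan

/-! The compatibility conditions collapse the double array of a point of `M` into one two-sided
sequence in `[0,1]` whose every term is `r` or `ρ` times the previous one. This identifies `M` with
the space of such trajectories under pointwise convergence (`isEmbedding_coord`), and `σ` with a
translation of time (`sigmaLim_eq_translate`).

A trajectory is identically `0` or everywhere positive, and then it is fixed by its value at time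
`0` and its sequence of multipliers. So `M` is a union of segments, the rays, issuing from the zero
trajectory. As `r < 1 < ρ`, the sign of an increment reveals the multiplier, so multipliers are
locally constant off the apex, and a connected set that misses the apex lies on one ray
(`sameRay_of_isPreconnected`, refined in `mem_of_between`). Hence arcs are forced
(`exists_minimal_path`), only the apex ramifies, and a non-zero point of maximal height on its ray
is an end-point. Smoothness is the joint continuity of scaling.

The remaining claims rest on `exists_gluing`. Since `log r / log ρ` is irrational, the products `r ^
k * ρ ^ l` are dense in `(0, ∞)`, so one trajectory can be continued by steps down and then up into
an almost full-size copy of another. Gluing two given points gives transitivity; gluing a given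
point to one that reaches height `1`, then rescaling, gives a nearby end-point. -/

namespace LelekFan

/-! ### Two-sided trajectories as coordinates on `M`. -/

section Coordinates

variable {r ρ : ℝ}

/-- The two-sided trajectories in `[0,1]` of the relation `L_{r,ρ}`. -/
def trajectories (r ρ : ℝ) : Set (ℤ → ℝ) :=
  {z | (∀ i, z i ∈ Icc (0 : ℝ) 1) ∧ ∀ i, z (i + 1) = r * z i ∨ z (i + 1) = ρ * z i}

/-- The `i`-th term of the two-sided trajectory that corresponds to a point of `M`. -/
def coord (x : MLim r ρ) (i : ℤ) : ℝ :=
  ((x.1 (-i).toNat).1 i.toNat : I)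

lemma val_eq_val_add (x : MLim r ρ) (n k m : ℕ) :
    (x.1 n).1 k = (x.1 (n + m)).1 (k + m) := by
  induction m with
  | zero => rfl
  | succ m ih =>
    rw [ih, x.2 (n + m)]
    rfl

/-- The array is constant along diagonals; moving back by `min n k` makes one index `0`, which is
where `coord` reads it. -/
lemma coe_val_eq_coord (x : MLim r ρ) (n k : ℕ) : (((x.1 n).1 k : I) : ℝ) = coord x (k - n) := by
  unfold coord
  rw [val_eq_val_add x (-((k : ℤ) - n)).toNat ((k : ℤ) - n).toNat (min n k),
    show (-((k : ℤ) - n)).toNat + min n k = n by omega,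
    show ((k : ℤ) - n).toNat + min n k = k by omega]

lemma coord_mem_trajectories (x : MLim r ρ) : coord x ∈ trajectories r ρ := by
  refine ⟨fun i => ((x.1 _).1 _).2, fun i => ?_⟩
  obtain ⟨n, k, rfl⟩ : ∃ n k : ℕ, i = k - n := ⟨(-i).toNat, i.toNat, by omega⟩
  have h := (x.1 n).2 k
  rw [show (k : ℤ) - n + 1 = ((k + 1 : ℕ) : ℤ) - n by push_cast; ring, ← coe_val_eq_coord,
    ← coe_val_eq_coord]
  exact h

/-- The point of `M` that corresponds to a two-sided trajectory. -/
def ofTrajectory (z : ℤ → ℝ) (hz : z ∈ trajectories r ρ) : MLim r ρ :=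
  ⟨fun n => ⟨fun k => ⟨z (k - n), hz.1 _⟩, fun k => by
      have h := hz.2 (k - n)
      rw [show (k : ℤ) - n + 1 = ((k + 1 : ℕ) : ℤ) - n by push_cast; ring] at h
      exact h⟩,
    fun n => by
      refine Subtype.ext (funext fun k => Subtype.ext ?_)
      change z (k - n) = z ((k + 1 : ℕ) - (n + 1 : ℕ))
      congr 1
      push_cast
      ring⟩

@[simp]
lemma coord_ofTrajectory (z : ℤ → ℝ) (hz : z ∈ trajectories r ρ) :
    coord (ofTrajectory z hz) = z := by
  funext i
  change z _ = z i
  congr 1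
  omega

lemma coord_injective : Function.Injective (coord : MLim r ρ → ℤ → ℝ) := by
  intro x y h
  refine Subtype.ext (funext fun n => Subtype.ext (funext fun k => Subtype.ext ?_))
  rw [coe_val_eq_coord, coe_val_eq_coord, h]

lemma isClosed_mahavierProduct {X : Type*} [TopologicalSpace X] {G : Set (X × X)}
    (hG : IsClosed G) : IsClosed (mahavierProduct G) := by
  simp only [mahavierProduct, ofPred_forall]
  exact isClosed_iInter fun i => hG.preimage (by fun_prop)

lemma continuous_mahavierShift {X : Type*} [TopologicalSpace X] (G : Set (X × X)) :
    Continuous (mahavierShift G) := by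
  have h : Continuous fun x : mahavierProduct G => fun i => x.1 (i + 1) :=
    continuous_pi fun i => (continuous_apply (i + 1)).comp continuous_subtype_val
  exact h.subtype_mk _

lemma isClosed_inverseLimit {X : Type*} [TopologicalSpace X] [T2Space X] {f : X → X}
    (hf : Continuous f) : IsClosed (inverseLimit f) := by
  simp only [inverseLimit, ofPred_forall]
  exact isClosed_iInter fun i => isClosed_eq (by fun_prop) (by fun_prop)

lemma isClosed_segmentRel (r : ℝ) : IsClosed (segmentRel r) :=
  isClosed_eq (by fun_prop) (by fun_prop)

instance compactSpace_MSpace : CompactSpace (MSpace r ρ) :=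
  isCompact_iff_compactSpace.mp (isClosed_mahavierProduct
    ((isClosed_segmentRel r).union (isClosed_segmentRel ρ))).isCompact

instance compactSpace_MLim : CompactSpace (MLim r ρ) :=
  isCompact_iff_compactSpace.mp
    (isClosed_inverseLimit (continuous_mahavierShift (relL r ρ))).isCompact

lemma metrizableSpace_MLim : TopologicalSpace.MetrizableSpace (MLim r ρ) :=
  TopologicalSpace.metrizableSpace_of_t3_secondCountable _

lemma continuous_coord : Continuous (coord : MLim r ρ → ℤ → ℝ) :=
  continuous_pi fun i => continuous_subtype_val.comp <| (continuous_apply i.toNat).comp <|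
    continuous_subtype_val.comp <| (continuous_apply (-i).toNat).comp continuous_subtype_val

@[fun_prop]
lemma continuous_coord_apply (i : ℤ) : Continuous fun x : MLim r ρ => coord x i :=
  (continuous_apply i).comp continuous_coord

/-- A continuous injection of a compact space into a Hausdorff one. -/
lemma isEmbedding_coord : IsEmbedding (coord : MLim r ρ → ℤ → ℝ) :=
  (continuous_coord.isClosedEmbedding coord_injective).isEmbedding

lemma continuous_ofTrajectory {Y : Type*} [TopologicalSpace Y] {z : Y → ℤ → ℝ}
    (hz : ∀ y, z y ∈ trajectories r ρ) (hc : ∀ i, Continuous fun y => z y i) :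
    Continuous fun y => ofTrajectory (z y) (hz y) := by
  rw [isEmbedding_coord.continuous_iff]
  simpa [Function.comp_def] using continuous_pi hc

lemma exists_window_of_mem_nhds {U : Set (MLim r ρ)} {u : MLim r ρ} (hU : U ∈ 𝓝 u) :
    ∃ n : ℕ, ∃ ε > 0, ∀ y, (∀ i : ℤ, |i| ≤ n → |coord y i - coord u i| < ε) → y ∈ U := by
  rw [isEmbedding_coord.isInducing.nhds_eq_comap, nhds_pi] at hU
  obtain ⟨V, hV, hVU⟩ := hU
  obtain ⟨F, hF, t, ht, htV⟩ := Filter.mem_pi.mp hV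
  have hε : ∀ i, ∃ ε > 0, Metric.ball (coord u i) ε ⊆ t i := fun i => Metric.mem_nhds_iff.mp (ht i)
  choose ε hε hεt using hε
  obtain ⟨δ, hδ, hδF⟩ : ∃ δ > 0, ∀ i ∈ F, δ ≤ ε i := by
    rcases F.eq_empty_or_nonempty with rfl | hne
    · exact ⟨1, one_pos, by simp⟩
    · obtain ⟨i, -, hi⟩ := hF.toFinset.exists_min_image ε (by simpa using hne)
      exact ⟨ε i, hε i, fun j hj => hi j (by simpa using hj)⟩
  obtain ⟨n, hn⟩ : ∃ n : ℕ, ∀ i ∈ F, |i| ≤ n := by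
    obtain ⟨b, hb⟩ := (hF.image fun i => i.natAbs).bddAbove
    refine ⟨b, fun i hi => ?_⟩
    have : i.natAbs ≤ b := hb (mem_image_of_mem _ hi)
    rw [Int.abs_eq_natAbs]
    exact_mod_cast this
  exact ⟨n, δ, hδ, fun y hy => hVU (htV fun i hi => hεt i
    (lt_of_lt_of_le (by simpa [Real.dist_eq] using hy i (hn i hi)) (hδF i hi)))⟩

lemma coord_nonneg (x : MLim r ρ) (i : ℤ) : 0 ≤ coord x i :=
  ((coord_mem_trajectories x).1 i).1

lemma coord_le_one (x : MLim r ρ) (i : ℤ) : coord x i ≤ 1 :=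
  ((coord_mem_trajectories x).1 i).2

lemma coord_add_one (x : MLim r ρ) (i : ℤ) :
    coord x (i + 1) = r * coord x i ∨ coord x (i + 1) = ρ * coord x i :=
  (coord_mem_trajectories x).2 i

lemma zero_mem_trajectories (r ρ : ℝ) : 0 ∈ trajectories r ρ :=
  ⟨by simp, by simp⟩

/-- The constant trajectory `0`. -/
def apex (r ρ : ℝ) : MLim r ρ :=
  ofTrajectory 0 (zero_mem_trajectories r ρ)

@[simp]
lemma coord_apex (i : ℤ) : coord (apex r ρ) i = 0 := by
  rw [apex, coord_ofTrajectory, Pi.zero_apply]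

lemma eq_apex_of_coord_eq_zero (h : NeverConnect r ρ) {x : MLim r ρ} {i : ℤ} (hi : coord x i = 0) :
    x = apex r ρ := by
  obtain ⟨hr, hρ, -⟩ := h
  refine coord_injective (funext fun j => ?_)
  rw [coord_apex]
  induction j using Int.inductionOn' (b := i) with
  | zero => exact hi
  | succ k _ ih => rcases coord_add_one x k with h | h <;> simp [h, ih]
  | pred k _ ih =>
    have h := coord_add_one x (k - 1)
    simp only [sub_add_cancel, ih, zero_eq_mul, hr.ne', hρ.ne', false_or, or_self] at h
    exact h

lemma coord_pos (h : NeverConnect r ρ) {x : MLim r ρ} (hx : x ≠ apex r ρ) (i : ℤ) :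
    0 < coord x i :=
  (coord_nonneg x i).lt_of_ne fun h0 => hx (eq_apex_of_coord_eq_zero h h0.symm)

end Coordinates

/-! ### Rays from the apex, scaling, and connected sets. -/

section Rays

variable {r ρ : ℝ}

/-- Two points of `M` are on the same ray if their trajectories are proportional. -/
def SameRay (x y : MLim r ρ) : Prop :=
  ∀ i, coord x i * coord y 0 = coord y i * coord x 0

lemma SameRay.symm {x y : MLim r ρ} (hxy : SameRay x y) : SameRay y x := fun i => (hxy i).symm

lemma sameRay_apex_left (x : MLim r ρ) : SameRay (apex r ρ) x := fun i => by simp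

lemma SameRay.coord_eq (h : NeverConnect r ρ) {x y : MLim r ρ} (hxy : SameRay x y)
    (hx : x ≠ apex r ρ) (i : ℤ) : coord y i = coord y 0 / coord x 0 * coord x i := by
  have h0 := coord_pos h hx 0
  have := hxy i
  field_simp
  linarith

/-- The middle point must not be the apex, which is on the same ray as every point. -/
lemma SameRay.trans (h : NeverConnect r ρ) {x y z : MLim r ρ} (hy : y ≠ apex r ρ)
    (hxy : SameRay x y) (hyz : SameRay y z) : SameRay x z := by
  intro i
  rw [hxy.symm.coord_eq h hy i, hyz.coord_eq h hy i]
  ring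

lemma SameRay.eq_of_coord_zero_eq (h : NeverConnect r ρ) {x y : MLim r ρ} (hxy : SameRay x y)
    (h0 : coord x 0 = coord y 0) : x = y := by
  by_cases hx : x = apex r ρ
  · subst hx
    exact (eq_apex_of_coord_eq_zero h (h0.symm.trans (coord_apex 0))).symm
  · refine coord_injective (funext fun i => ?_)
    rw [hxy.coord_eq h hx i, ← h0, div_self (coord_pos h hx 0).ne', one_mul]

/-- Proportional trajectories can use the same multiplier at each step, and the recursion with a
fixed multiplier is linear. -/
lemma smul_add_smul_mem_trajectories (h : NeverConnect r ρ) {x y : MLim r ρ} (hxy : SameRay x y)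
    {s t : ℝ} (hs : 0 ≤ s) (ht : 0 ≤ t) (hst : s + t ≤ 1) :
    s • coord x + t • coord y ∈ trajectories r ρ := by
  have key : ∀ i, coord x (i + 1) = r * coord x i ∧ coord y (i + 1) = r * coord y i ∨
      coord x (i + 1) = ρ * coord x i ∧ coord y (i + 1) = ρ * coord y i := by
    intro i
    by_cases hx : x = apex r ρ
    · simpa [hx] using coord_add_one y i
    · have e := hxy.coord_eq h hx
      rw [e i, e (i + 1)]
      rcases coord_add_one x i with h1 | h1 <;> rw [h1]
      · left; constructor <;> ring
      · right; constructor <;> ring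
  refine ⟨fun i => ⟨?_, ?_⟩, fun i => ?_⟩
  · have := coord_nonneg x i
    have := coord_nonneg y i
    simp only [Pi.add_apply, Pi.smul_apply, smul_eq_mul]
    positivity
  · have := mul_le_mul_of_nonneg_left (coord_le_one x i) hs
    have := mul_le_mul_of_nonneg_left (coord_le_one y i) ht
    simp only [Pi.add_apply, Pi.smul_apply, smul_eq_mul]
    linarith
  · simp only [Pi.add_apply, Pi.smul_apply, smul_eq_mul]
    rcases key i with ⟨h1, h2⟩ | ⟨h1, h2⟩ <;> rw [h1, h2]
    · left; ring
    · right; ring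

lemma smul_mem_trajectories (x : MLim r ρ) (t : I) : (t : ℝ) • coord x ∈ trajectories r ρ := by
  refine ⟨fun i => ⟨mul_nonneg t.2.1 (coord_nonneg x i),
    mul_le_one₀ t.2.2 (coord_nonneg x i) (coord_le_one x i)⟩, fun i => ?_⟩
  simp only [Pi.smul_apply, smul_eq_mul]
  rcases coord_add_one x i with h1 | h1 <;> rw [h1]
  · left; ring
  · right; ring

/-- The multiple `t x` of a point `x` of `M`. -/
def scale (x : MLim r ρ) (t : I) : MLim r ρ :=
  ofTrajectory _ (smul_mem_trajectories x t)

@[simp]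
lemma coord_scale (x : MLim r ρ) (t : I) (i : ℤ) : coord (scale x t) i = t * coord x i := by
  rw [scale, coord_ofTrajectory, Pi.smul_apply, smul_eq_mul]

lemma continuous_scale : Continuous (scale : MLim r ρ → I → MLim r ρ).uncurry :=
  continuous_ofTrajectory (fun p : MLim r ρ × I => smul_mem_trajectories p.1 p.2) fun i => by
    simp only [Pi.smul_apply, smul_eq_mul]
    fun_prop

lemma continuous_scale_right (x : MLim r ρ) : Continuous (scale x) :=
  continuous_scale.comp (Continuous.prodMk_right x)

@[simp]
lemma scale_zero (x : MLim r ρ) : scale x 0 = apex r ρ :=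
  coord_injective (funext fun i => by simp)

@[simp]
lemma scale_one (x : MLim r ρ) : scale x 1 = x :=
  coord_injective (funext fun i => by simp)

lemma sameRay_scale (x : MLim r ρ) (t : I) : SameRay x (scale x t) := fun i => by
  rw [coord_scale, coord_scale]
  ring

lemma injective_scale (h : NeverConnect r ρ) {x : MLim r ρ} (hx : x ≠ apex r ρ) :
    Function.Injective (scale x) := fun s t hst => by
  have := congrArg (coord · 0) hst
  simpa [(coord_pos h hx 0).ne', Subtype.ext_iff] using this

lemma scale_eq_apex_iff (h : NeverConnect r ρ) {x : MLim r ρ} (hx : x ≠ apex r ρ) {t : I} :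
    scale x t = apex r ρ ↔ t = 0 := by
  rw [← scale_zero x, (injective_scale h hx).eq_iff]

/-! ### Connected subsets -/

/-- A positive trajectory falls under `r` and rises under `ρ`, so increments of equal sign mean
equal multipliers. This turns a discrete condition into an open one. -/
lemma same_step (h : NeverConnect r ρ) {x y : MLim r ρ} (hx : x ≠ apex r ρ) (hy : y ≠ apex r ρ)
    {i : ℤ} (hi : 0 < (coord y (i + 1) - coord y i) * (coord x (i + 1) - coord x i)) :
    ∃ a ≠ 0, coord x (i + 1) = a * coord x i ∧ coord y (i + 1) = a * coord y i := by
  have hx0 := coord_pos h hx i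
  have hy0 := coord_pos h hy i
  obtain ⟨hr, hρ, hr1, hρ1, -⟩ := h
  have hpos := mul_pos hy0 hx0
  have hneg : (r - 1) * (ρ - 1) < 0 := mul_neg_of_neg_of_pos (by linarith) (by linarith)
  rcases coord_add_one x i with h1 | h1 <;> rcases coord_add_one y i with h2 | h2
  · exact ⟨r, hr.ne', h1, h2⟩
  · rw [h1, h2] at hi
    nlinarith
  · rw [h1, h2] at hi
    nlinarith
  · exact ⟨ρ, hρ.ne', h1, h2⟩

lemma step_ne (h : NeverConnect r ρ) {x : MLim r ρ} (hx : x ≠ apex r ρ) (i : ℤ) :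
    coord x (i + 1) - coord x i ≠ 0 := by
  have hx0 := coord_pos h hx i
  obtain ⟨hr, hρ, hr1, hρ1, -⟩ := h
  rcases coord_add_one x i with h1 | h1 <;> rw [h1] <;> nlinarith

/-- Proportionality spreads from time `0` both ways; going back cancels the multiplier. The finite
window is what `mem_of_between` needs. -/
lemma proportional_of_same_steps (h : NeverConnect r ρ) {x y : MLim r ρ} (hx : x ≠ apex r ρ)
    (hy : y ≠ apex r ρ) (n : ℕ) (hn : ∀ i : ℤ, |i| ≤ n →
      0 < (coord y (i + 1) - coord y i) * (coord x (i + 1) - coord x i)) (k : ℕ) (hk : k ≤ n) :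
    coord x k * coord y 0 = coord y k * coord x 0 ∧
      coord x (-k) * coord y 0 = coord y (-k) * coord x 0 := by
  induction k with
  | zero => simp [mul_comm]
  | succ k ih =>
    obtain ⟨ih1, ih2⟩ := ih (by omega)
    obtain ⟨a, -, h1, h2⟩ := same_step h hx hy (hn k (by rw [abs_le]; omega))
    obtain ⟨b, hb, h3, h4⟩ := same_step h hx hy (hn (-((k + 1 : ℕ) : ℤ)) (by rw [abs_le]; omega))
    rw [show -((k + 1 : ℕ) : ℤ) + 1 = -k by push_cast; ring] at h3 h4
    constructor
    · push_cast
      rw [h1, h2, mul_assoc, ih1, mul_assoc]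
    · rw [h3, h4, mul_assoc, mul_assoc] at ih2
      exact mul_left_cancel₀ hb ih2

lemma sameRay_of_same_steps (h : NeverConnect r ρ) {x y : MLim r ρ} (hx : x ≠ apex r ρ)
    (hy : y ≠ apex r ρ)
    (hn : ∀ i : ℤ, 0 < (coord y (i + 1) - coord y i) * (coord x (i + 1) - coord x i)) :
    SameRay x y := by
  intro i
  have key := proportional_of_same_steps h hx hy i.natAbs (fun i _ => hn i) i.natAbs le_rfl
  rcases Int.natAbs_eq i with hi | hi
  · rw [hi]; exact key.1
  · rw [hi]; exact key.2

/-- Off the apex each increment is continuous and never zero, so its sign is constant on `S`. -/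
lemma sameRay_of_isPreconnected (h : NeverConnect r ρ) {S : Set (MLim r ρ)} (hS : IsPreconnected S)
    (h0 : apex r ρ ∉ S) {x y : MLim r ρ} (hx : x ∈ S) (hy : y ∈ S) : SameRay x y := by
  have ne : ∀ {z}, z ∈ S → z ≠ apex r ρ := fun hz hz0 => h0 (hz0 ▸ hz)
  refine sameRay_of_same_steps h (ne hx) (ne hy) fun i => ?_
  by_contra hi
  obtain ⟨z, -, hz1, hz2⟩ := hS
    {z | 0 < (coord z (i + 1) - coord z i) * (coord x (i + 1) - coord x i)}
    {z | (coord z (i + 1) - coord z i) * (coord x (i + 1) - coord x i) < 0}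
    (isOpen_lt (by fun_prop) (by fun_prop)) (isOpen_lt (by fun_prop) (by fun_prop))
    (fun z hz => (mul_ne_zero (step_ne h (ne hz) i) (step_ne h (ne hx) i)).lt_or_gt.symm)
    ⟨x, hx, mul_self_pos.mpr (step_ne h (ne hx) i)⟩
    ⟨y, hy, lt_of_le_of_ne (not_lt.mp hi)
      (mul_ne_zero (step_ne h (ne hy) i) (step_ne h (ne hx) i))⟩
  exact lt_asymm hz1.out hz2.out

/-- A closed connected subset that contains two points of a ray contains the points between. -/
lemma mem_of_between (h : NeverConnect r ρ) {C : Set (MLim r ρ)} (hC : IsClosed C)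
    (hC' : IsPreconnected C) {w x z : MLim r ρ} (hw : w ∈ C) (hx : x ∈ C)
    (hxz : SameRay x z) (hwz : SameRay w z) (h1 : coord w 0 ≤ coord z 0)
    (h2 : coord z 0 ≤ coord x 0) : z ∈ C := by
  by_contra hz
  have h1' : coord w 0 < coord z 0 :=
    h1.lt_of_ne fun e => hz (hwz.eq_of_coord_zero_eq h e ▸ hw)
  have h2' : coord z 0 < coord x 0 :=
    h2.lt_of_ne fun e => hz (hxz.eq_of_coord_zero_eq h e.symm ▸ hx)
  have hz0 : 0 < coord z 0 := (coord_nonneg w 0).trans_lt h1'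
  have hx0 : x ≠ apex r ρ := by
    rintro rfl
    rw [coord_apex] at h2'
    exact lt_asymm hz0 h2'
  obtain ⟨n, ε, hε, hn⟩ := exists_window_of_mem_nhds (hC.isOpen_compl.mem_nhds hz)
  -- If `z` is missing, so is a window neighbourhood of it. The first open set holds the points
  -- above `z` with the steps of `x` in the window, the second those below `z` or with a different
  -- step. A point in neither has the height and steps of `z`, so it agrees with `z` on the window
  -- and is not in `C`.
  refine absurd (hC'
    ({y | coord z 0 < coord y 0} ∩
      ⋂ i ∈ Finset.Icc (-n : ℤ) n,
        {y | 0 < (coord y (i + 1) - coord y i) * (coord x (i + 1) - coord x i)})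
    ({y | coord y 0 < coord z 0} ∪
      ⋃ i ∈ Finset.Icc (-n : ℤ) n,
        {y | (coord y (i + 1) - coord y i) * (coord x (i + 1) - coord x i) < 0})
    ((isOpen_lt (by fun_prop) (by fun_prop)).inter
      (isOpen_biInter_finset fun i _ => isOpen_lt (by fun_prop) (by fun_prop)))
    ((isOpen_lt (by fun_prop) (by fun_prop)).union
      (isOpen_biUnion fun i _ => isOpen_lt (by fun_prop) (by fun_prop)))
    ?_
    ⟨x, hx, h2', mem_iInter₂.mpr fun i _ => mul_self_pos.mpr (step_ne h hx0 i)⟩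
    ⟨w, hw, Or.inl h1'⟩) ?_
  · intro y hy
    by_contra hcon
    simp only [mem_union, mem_inter_iff, mem_iInter, mem_iUnion, mem_ofPred_eq, not_or, not_and,
      not_exists, not_lt, not_forall] at hcon
    obtain ⟨hc1, hc2, hc3⟩ := hcon
    have hy0 : y ≠ apex r ρ := by
      rintro rfl
      rw [coord_apex] at hc2
      exact absurd hz0 (not_lt.mpr hc2)
    have hsteps : ∀ i : ℤ, |i| ≤ n →
        0 < (coord y (i + 1) - coord y i) * (coord x (i + 1) - coord x i) := fun i hi =>
      lt_of_le_of_ne (hc3 i (by simpa [abs_le] using hi))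
        (mul_ne_zero (step_ne h hy0 i) (step_ne h hx0 i)).symm
    have hyz : coord y 0 = coord z 0 := by
      refine le_antisymm (not_lt.mp fun hlt => ?_) hc2
      obtain ⟨i, hi, hle⟩ := hc1 hlt
      exact absurd (hsteps i (by simpa [abs_le] using hi)) (not_lt.mpr hle)
    refine hn y (fun i hi => ?_) hy
    have key := proportional_of_same_steps h hx0 hy0 n hsteps i.natAbs (by
      rw [Int.abs_eq_natAbs] at hi
      exact_mod_cast hi)
    have hprop : coord x i * coord y 0 = coord y i * coord x 0 := by
      rcases Int.natAbs_eq i with hi | hi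
      · rw [hi]; exact key.1
      · rw [hi]; exact key.2
    have : coord y i = coord z i :=
      mul_right_cancel₀ (coord_pos h hx0 0).ne' (by rw [← hprop, ← hxz i, hyz])
    rwa [this, sub_self, abs_zero]
  · rintro ⟨y, -, ⟨hy1, hy1'⟩, hy2⟩
    rcases hy2 with hy2 | hy2
    · exact lt_asymm hy1.out hy2.out
    · obtain ⟨i, hi, hy2⟩ := mem_iUnion₂.mp hy2
      exact lt_asymm (mem_iInter₂.mp hy1' i hi).out hy2.out

lemma scale_mem (h : NeverConnect r ρ) {C : Set (MLim r ρ)} (hC : IsClosed C)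
    (hC' : IsPreconnected C) (h0 : apex r ρ ∈ C) {x : MLim r ρ} (hx : x ∈ C) (t : I) :
    scale x t ∈ C :=
  mem_of_between h hC hC' h0 hx (sameRay_scale x t) (sameRay_apex_left _)
    (by simpa using coord_nonneg (scale x t) 0)
    (by simpa using mul_le_of_le_one_left (coord_nonneg x 0) t.2.2)

end Rays

lemma isArcBetween_range {X : Type*} [TopologicalSpace X] [T2Space X] {γ : I → X}
    (hγ : Continuous γ) (hi : Function.Injective γ) : IsArcBetween (range γ) (γ 0) (γ 1) :=
  ⟨(hγ.isClosedEmbedding hi).isEmbedding.toHomeomorph, rfl, rfl⟩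

lemma IsSubcontinuum.isCompact {X : Type*} [TopologicalSpace X] {A : Set X}
    (hA : IsSubcontinuum A) : IsCompact A :=
  isCompact_iff_compactSpace.mpr hA.1

lemma IsSubcontinuum.isConnected {X : Type*} [TopologicalSpace X] {A : Set X}
    (hA : IsSubcontinuum A) : IsConnected A :=
  isConnected_iff_connectedSpace.mpr hA.2.1

/-! ### Finite unions of segments from the apex. -/

section Spider

variable {r ρ : ℝ} {ι : Type*} [Fintype ι]

lemma exists_forall_ne_eq_zero [Nonempty ι] {s : ι → I} (hs : ∀ i j, i ≠ j → s i = 0 ∨ s j = 0) :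
    ∃ j, ∀ i, i ≠ j → s i = 0 := by
  by_cases hj : ∃ j, s j ≠ 0
  · obtain ⟨j, hj⟩ := hj
    exact ⟨j, fun i hi => (hs i j hi).resolve_right hj⟩
  · push Not at hj
    exact ⟨Classical.arbitrary ι, fun i _ => hj i⟩

lemma sum_smul_coord_eq (a : ι → MLim r ρ) {s : ι → I} {j : ι} (hj : ∀ i, i ≠ j → s i = 0) :
    ∑ i, (s i : ℝ) • coord (a i) = (s j : ℝ) • coord (a j) :=
  Finset.sum_eq_single j (fun i _ hi => by simp [hj i hi]) (by simp)

lemma sum_smul_coord_mem_trajectories [Nonempty ι] (a : ι → MLim r ρ) {s : ι → I}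
    (hs : ∀ i j, i ≠ j → s i = 0 ∨ s j = 0) :
    ∑ i, (s i : ℝ) • coord (a i) ∈ trajectories r ρ := by
  obtain ⟨j, hj⟩ := exists_forall_ne_eq_zero hs
  rw [sum_smul_coord_eq a hj]
  exact smul_mem_trajectories _ _

/-- The point with parameters `s` on the union of the segments from the apex to the `a i`; at most
one of the parameters is not zero. -/
def spider [Nonempty ι] (a : ι → MLim r ρ) (s : ι → I)
    (hs : ∀ i j, i ≠ j → s i = 0 ∨ s j = 0) : MLim r ρ :=
  ofTrajectory _ (sum_smul_coord_mem_trajectories a hs)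

variable [Nonempty ι]

lemma spider_eq_scale (a : ι → MLim r ρ) {s : ι → I} (hs : ∀ i j, i ≠ j → s i = 0 ∨ s j = 0)
    {j : ι} (hj : ∀ i, i ≠ j → s i = 0) : spider a s hs = scale (a j) (s j) :=
  coord_injective (by rw [spider, scale, coord_ofTrajectory, coord_ofTrajectory,
    sum_smul_coord_eq a hj])

/-- Segments on different rays meet only in the apex. -/
lemma spider_injective (h : NeverConnect r ρ) {a : ι → MLim r ρ}
    (ha : ∀ i j, i ≠ j → ¬ SameRay (a i) (a j)) (ha0 : ∀ i, a i ≠ apex r ρ) {s t : ι → I}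
    (hs : ∀ i j, i ≠ j → s i = 0 ∨ s j = 0) (ht : ∀ i j, i ≠ j → t i = 0 ∨ t j = 0)
    (hst : spider a s hs = spider a t ht) : s = t := by
  obtain ⟨j, hj⟩ := exists_forall_ne_eq_zero hs
  obtain ⟨k, hk⟩ := exists_forall_ne_eq_zero ht
  rw [spider_eq_scale a hs hj, spider_eq_scale a ht hk] at hst
  by_cases hjk : j = k
  · subst hjk
    have := injective_scale h (ha0 j) hst
    funext i
    by_cases hi : i = j
    · rw [hi, this]
    · rw [hj i hi, hk i hi]
  · have h0 : s j = 0 := by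
      by_contra h0
      refine ha j k hjk (SameRay.trans h (y := scale (a j) (s j)) ?_ (sameRay_scale _ _) ?_)
      · rwa [Ne, scale_eq_apex_iff h (ha0 j)]
      · rw [hst]
        exact (sameRay_scale _ _).symm
    have h1 : t k = 0 := by
      rw [← scale_eq_apex_iff h (ha0 k), ← hst, h0, scale_zero]
    funext i
    rw [show s i = 0 from (eq_or_ne i j).elim (fun e => e ▸ h0) (hj i),
      show t i = 0 from (eq_or_ne i k).elim (fun e => e ▸ h1) (hk i)]

lemma continuous_spider {Y : Type*} [TopologicalSpace Y] (a : ι → MLim r ρ) {s : Y → ι → I}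
    (hs : ∀ y i j, i ≠ j → s y i = 0 ∨ s y j = 0) (hc : ∀ i, Continuous fun y => s y i) :
    Continuous fun y => spider a (s y) (hs y) :=
  continuous_ofTrajectory (fun y => sum_smul_coord_mem_trajectories a (hs y)) fun i => by
    simp only [Finset.sum_apply, Pi.smul_apply, smul_eq_mul]
    fun_prop

end Spider

/-- The two projections are the positive and negative parts of `u`. -/
lemma projIcc_sub_projIcc_neg {u : ℝ} (hu : u ∈ Icc (-1 : ℝ) 1) :
    (projIcc 0 1 zero_le_one u : ℝ) - projIcc 0 1 zero_le_one (-u) = u := by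
  rw [coe_projIcc, coe_projIcc, min_eq_right hu.2, min_eq_right (by linarith [hu.1])]
  rcases le_total 0 u with h | h
  · rw [max_eq_right h, max_eq_left (by linarith), sub_zero]
  · rw [max_eq_left h, max_eq_right (by linarith), zero_sub, neg_neg]

lemma projIcc_eq_zero_or_neg (u : ℝ) :
    projIcc 0 1 zero_le_one u = (0 : I) ∨ projIcc 0 1 zero_le_one (-u) = (0 : I) := by
  rcases le_total u 0 with h | h
  · exact Or.inl (projIcc_of_le_left _ h)
  · exact Or.inr (projIcc_of_le_left _ (by linarith))

/-! ### Arcs and hereditary unicoherence. -/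

section Dendroid

variable {r ρ : ℝ}

/-- Two points of `M` are joined by an arc that lies in every closed connected set containing
them. -/
lemma exists_minimal_path (h : NeverConnect r ρ) (x y : MLim r ρ) :
    ∃ γ : I → MLim r ρ, Continuous γ ∧ γ 0 = x ∧ γ 1 = y ∧ (x ≠ y → Function.Injective γ) ∧
      ∀ C : Set (MLim r ρ), IsClosed C → IsPreconnected C → x ∈ C → y ∈ C → range γ ⊆ C := by
  by_cases hxy : SameRay x y
  · have hz : ∀ t : I, (1 - t : ℝ) • coord x + (t : ℝ) • coord y ∈ trajectories r ρ := fun t =>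
      smul_add_smul_mem_trajectories h hxy (sub_nonneg.mpr t.2.2) t.2.1 (by linarith)
    have hc : ∀ (t : I) i,
        coord (ofTrajectory _ (hz t)) i = (1 - t) * coord x i + t * coord y i := fun t i => by
      rw [coord_ofTrajectory]; rfl
    refine ⟨fun t => ofTrajectory _ (hz t), continuous_ofTrajectory hz fun i => ?_,
      coord_injective (by simp), coord_injective (by simp), fun hne s t hst => ?_,
      fun C hC hC' hx hy => ?_⟩
    · simp only [Pi.add_apply, Pi.smul_apply, smul_eq_mul]
      fun_prop
    · have h0 := congrArg (coord · 0) hst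
      simp only [hc] at h0
      have hne' : coord x 0 ≠ coord y 0 := fun e => hne (hxy.eq_of_coord_zero_eq h e)
      refine Subtype.ext (mul_right_cancel₀ (sub_ne_zero.mpr hne') ?_)
      linear_combination -h0
    · rintro _ ⟨t, rfl⟩
      have h1 : SameRay x (ofTrajectory _ (hz t)) := fun i => by
        rw [hc, hc]
        linear_combination (t : ℝ) * hxy i
      have h2 : SameRay y (ofTrajectory _ (hz t)) := fun i => by
        rw [hc, hc]
        linear_combination -(1 - (t : ℝ)) * hxy i
      have ht0 := t.2.1
      have ht1 := t.2.2
      rcases le_total (coord x 0) (coord y 0) with hle | hle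
      · refine mem_of_between h hC hC' hx hy h2 h1 ?_ ?_ <;> rw [hc] <;> nlinarith
      · refine mem_of_between h hC hC' hy hx h1 h2 ?_ ?_ <;> rw [hc] <;> nlinarith
  · have hx0 : x ≠ apex r ρ := by
      rintro rfl
      exact hxy (sameRay_apex_left y)
    have hy0 : y ≠ apex r ρ := by
      rintro rfl
      exact hxy (sameRay_apex_left x).symm
    -- Positive and negative parts of `1 - 2t`: the path descends from `x` to the apex at `t = 1/2`,
    -- then climbs to `y`.
    set s : I → Fin 2 → I := fun t =>
      ![projIcc 0 1 zero_le_one (1 - 2 * (t : ℝ)), projIcc 0 1 zero_le_one (-(1 - 2 * (t : ℝ)))]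
      with hs_def
    have hs : ∀ t i j, i ≠ j → s t i = 0 ∨ s t j = 0 := by
      intro t
      have := projIcc_eq_zero_or_neg (1 - 2 * (t : ℝ))
      rw [Fin.forall_fin_two]
      simp only [Fin.forall_fin_two]
      simpa [s, or_comm] using this
    refine ⟨fun t => spider ![x, y] (s t) (hs t), continuous_spider _ hs ?_, ?_, ?_, ?_, ?_⟩
    · have hp : Continuous (projIcc (0 : ℝ) 1 zero_le_one) :=
        continuous_projIcc (h := zero_le_one)
      rw [Fin.forall_fin_two]
      constructor
      · exact hp.comp (by fun_prop)
      · exact hp.comp (by fun_prop)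
    · have h1 : s 0 0 = 1 := projIcc_of_right_le zero_le_one (by simp)
      have h2 : s 0 1 = 0 := projIcc_of_le_left zero_le_one (by simp)
      dsimp only
      rw [spider_eq_scale _ _ (j := 0), h1]
      · exact scale_one x
      · simpa [Fin.forall_fin_two] using h2
    · have h1 : s 1 1 = 1 := projIcc_of_right_le zero_le_one (by norm_num)
      have h2 : s 1 0 = 0 := projIcc_of_le_left zero_le_one (by norm_num)
      dsimp only
      rw [spider_eq_scale _ _ (j := 1), h1]
      · exact scale_one y
      · simpa [Fin.forall_fin_two] using h2
    · intro _ t t' htt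
      have hst := spider_injective h (a := ![x, y])
        (by simpa [Fin.forall_fin_two] using ⟨hxy, fun h' => hxy h'.symm⟩)
        (by simpa [Fin.forall_fin_two] using ⟨hx0, hy0⟩) (hs t) (hs t') htt
      have mem : ∀ t : I, (1 - 2 * (t : ℝ)) ∈ Icc (-1 : ℝ) 1 := fun t =>
        ⟨by linarith [t.2.2], by linarith [t.2.1]⟩
      have e := projIcc_sub_projIcc_neg (mem t)
      have e' := projIcc_sub_projIcc_neg (mem t')
      have h0 : projIcc 0 1 zero_le_one (1 - 2 * (t : ℝ)) =
        projIcc 0 1 zero_le_one (1 - 2 * (t' : ℝ)) := congrFun hst 0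
      have h1 : projIcc 0 1 zero_le_one (-(1 - 2 * (t : ℝ))) =
        projIcc 0 1 zero_le_one (-(1 - 2 * (t' : ℝ))) := congrFun hst 1
      rw [h0, h1, e'] at e
      exact Subtype.ext (by linarith)
    · rintro C hC hC' hx hy _ ⟨t, rfl⟩
      have h0 : apex r ρ ∈ C := by
        by_contra h0
        exact hxy (sameRay_of_isPreconnected h hC' h0 hx hy)
      obtain ⟨j, hj⟩ := exists_forall_ne_eq_zero (hs t)
      dsimp only
      rw [spider_eq_scale _ _ hj]
      refine scale_mem h hC hC' h0 ?_ _
      fin_cases j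
      · exact hx
      · exact hy

lemma isContinuum_MLim : IsContinuum (MLim r ρ) := by
  refine ⟨compactSpace_MLim, ?_, metrizableSpace_MLim⟩
  rw [connectedSpace_iff_univ]
  refine ⟨⟨apex r ρ, mem_univ _⟩, isPreconnected_of_forall (apex r ρ) fun x _ =>
    ⟨range (scale x), subset_univ _, ⟨0, scale_zero x⟩, ⟨1, scale_one x⟩, ?_⟩⟩
  exact isPreconnected_range (continuous_scale_right x)

/-- The minimal path between two points of `A ∩ B` lies in both `A` and `B`, so the intersection is
preconnected; it is non-empty because `Y` is connected. -/
lemma isDendroid_MLim (h : NeverConnect r ρ) : IsDendroid (MLim r ρ) := by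
  refine ⟨isContinuum_MLim, fun x y hxy => ?_, fun Y hY A B hA hB hAB => ⟨?_, ?_⟩⟩
  · obtain ⟨γ, hγ, rfl, rfl, hi, -⟩ := exists_minimal_path h x y
    exact ⟨_, isArcBetween_range hγ (hi hxy)⟩
  · have hYc := isPreconnected_closed_iff.mp hY.isConnected.isPreconnected A B
      hA.isCompact.isClosed hB.isCompact.isClosed hAB.ge
      (by rw [← hAB, inter_eq_right.mpr subset_union_left]; exact hA.isConnected.nonempty)
      (by rw [← hAB, inter_eq_right.mpr subset_union_right]; exact hB.isConnected.nonempty)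
    exact hYc.mono inter_subset_right
  · refine isPreconnected_of_forall_pair fun x hx y hy => ?_
    obtain ⟨γ, hγ, h0, h1, -, hC⟩ := exists_minimal_path h x y
    exact ⟨range γ, subset_inter
      (hC A hA.isCompact.isClosed hA.isConnected.isPreconnected hx.1 hy.1)
      (hC B hB.isCompact.isClosed hB.isConnected.isPreconnected hx.2 hy.2),
      ⟨0, h0⟩, ⟨1, h1⟩, isPreconnected_range hγ⟩

end Dendroid

/-! ### Initial directions of paths, and end-points. -/

section Legs

variable {r ρ : ℝ}

lemma exists_sameRay_initial_segment (h : NeverConnect r ρ) {α : I → MLim r ρ} (hα : Continuous α)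
    (h0 : α 0 ≠ apex r ρ) : ∃ a : I, 0 < a ∧ ∀ t ≤ a, SameRay (α 0) (α t) := by
  have hU : IsOpen {t | α t ≠ apex r ρ} := isOpen_ne.preimage hα
  obtain ⟨δ, hδ, hδU⟩ := Metric.isOpen_iff.mp hU 0 h0
  refine ⟨⟨min (δ / 2) 1, by positivity, min_le_right _ _⟩, ?_, fun t ht => ?_⟩
  · rw [← Subtype.coe_lt_coe]
    exact lt_min (by positivity) one_pos
  · refine sameRay_of_isPreconnected h (isPreconnected_Iic.image α hα.continuousOn)
      (S := α '' Iic ⟨min (δ / 2) 1, by positivity, min_le_right _ _⟩) ?_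
      ⟨0, mem_Iic.mpr bot_le, rfl⟩ ⟨t, ht, rfl⟩
    rintro ⟨s, hs, hs0⟩
    refine hδU (a := s) ?_ hs0
    have hs1 : (s : ℝ) ≤ min (δ / 2) 1 := hs
    have hs2 : (s : ℝ) ≤ δ / 2 := hs1.trans (min_le_left _ _)
    rw [Metric.mem_ball, Subtype.dist_eq, Real.dist_eq, Icc.coe_zero, sub_zero,
      abs_of_nonneg s.2.1]
    linarith

/-- An injective path that starts at a point other than the apex initially moves along the ray of
its starting point, in one of the two directions. -/
lemma exists_initial_direction (h : NeverConnect r ρ) {α : I → MLim r ρ} (hα : Continuous α)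
    (hi : Function.Injective α) (h0 : α 0 ≠ apex r ρ) :
    ∃ a : I, (∀ t ≤ a, SameRay (α 0) (α t)) ∧
      (coord (α a) 0 < coord (α 0) 0 ∨ coord (α 0) 0 < coord (α a) 0) := by
  obtain ⟨a, ha, hs⟩ := exists_sameRay_initial_segment h hα h0
  exact ⟨a, hs, lt_or_gt_of_ne fun e =>
    ha.ne (hi ((hs a le_rfl).eq_of_coord_zero_eq h e.symm))⟩

/-- Two paths that start at the same point and move along its ray in the same direction meet
again. -/
lemma not_same_direction (h : NeverConnect r ρ) {α β : I → MLim r ρ} (hα : Continuous α)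
    (hβ : Continuous β) (hαβ : α 0 = β 0) (h0 : α 0 ≠ apex r ρ)
    (hmeet : ∀ s t, α s = β t → s = 0 ∧ t = 0) {a b : I} (ha : ∀ t ≤ a, SameRay (α 0) (α t))
    (hb : ∀ t ≤ b, SameRay (β 0) (β t)) {c : ℝ} (hc : c ≠ 0)
    (ha' : c * coord (α a) 0 < c * coord (α 0) 0)
    (hb' : c * coord (β b) 0 < c * coord (β 0) 0) : False := by
  wlog hle : c * coord (α a) 0 ≤ c * coord (β b) 0 generalizing α β a b
  · exact this hβ hα hαβ.symm (hαβ ▸ h0) (fun s t hst => (hmeet t s hst.symm).symm) hb ha hb' ha'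
      (le_of_not_ge hle)
  -- The path that travels further passes the height of `β b`; on a common ray equal height means
  -- equal points. The sign of `c` covers both directions.
  · obtain ⟨s, hs, hs'⟩ := intermediate_value_Icc' (a := (0 : I)) (b := a) bot_le
      (f := fun t => c * coord (α t) 0) (by fun_prop) ⟨hle, by rw [hαβ]; exact hb'.le⟩
    have hray : SameRay (α s) (β b) :=
      (ha s hs.2).symm.trans h h0 (hαβ ▸ hb b le_rfl)
    obtain ⟨-, rfl⟩ := hmeet s b (hray.eq_of_coord_zero_eq h (mul_left_cancel₀ hc hs'))
    exact lt_irrefl _ hb'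

/-- If `x` were interior to an arc, both halves would leave it along its ray, necessarily downwards,
and would meet again. -/
lemma mem_endPoints_of_forall_le (h : NeverConnect r ρ) {x : MLim r ρ} (hx : x ≠ apex r ρ)
    (hmax : ∀ y, SameRay x y → coord y 0 ≤ coord x 0) : x ∈ endPoints (MLim r ρ) := by
  rintro A ⟨φ⟩ hxA
  set p : I := φ.symm ⟨x, hxA⟩ with hp
  have hφp : (φ p : MLim r ρ) = x := by simp [hp]
  by_cases hp0 : p = 0
  · exact ⟨φ, hp0 ▸ hφp⟩
  by_cases hp1 : p = 1
  · refine ⟨unitInterval.symmHomeomorph.trans φ, ?_⟩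
    rw [← hφp, hp1]
    simp
  exfalso
  set ψ : I → MLim r ρ := fun t => (φ t : MLim r ρ)
  have hψ : Continuous ψ := by fun_prop
  have hψi : Function.Injective ψ := Subtype.val_injective.comp φ.injective
  have hpos : 0 < (p : ℝ) := unitInterval.pos_iff_ne_zero.mpr hp0
  have hlt : (p : ℝ) < 1 := unitInterval.lt_one_iff_ne_one.mpr hp1
  -- The parameter `1 - (1 - p)(1 - t)` runs from `p` to `1`, and that of `β` from `p` to `0`.
  set α : I → MLim r ρ := fun t => ψ (unitInterval.symm (unitInterval.symm p * unitInterval.symm t))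
  set β : I → MLim r ρ := fun t => ψ (p * unitInterval.symm t)
  have hα : Continuous α := hψ.comp (by fun_prop)
  have hβ : Continuous β := hψ.comp (by fun_prop)
  have hα0 : α 0 = x := by simp [α, ψ, hφp]
  have hβ0 : β 0 = x := by simp [β, ψ, hφp]
  have hαi : Function.Injective α := fun s t hst => by
    have e := congrArg Subtype.val (hψi hst)
    simp only [unitInterval.coe_symm_eq, Icc.coe_mul] at e
    refine Subtype.ext (mul_left_cancel₀ (sub_pos.mpr hlt).ne' ?_)
    linear_combination e
  have hβi : Function.Injective β := fun s t hst => by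
    have e := congrArg Subtype.val (hψi hst)
    simp only [unitInterval.coe_symm_eq, Icc.coe_mul] at e
    refine Subtype.ext (mul_left_cancel₀ hpos.ne' ?_)
    linear_combination -e
  have hmeet : ∀ s t, α s = β t → s = 0 ∧ t = 0 := fun s t hst => by
    have e := congrArg Subtype.val (hψi hst)
    simp only [unitInterval.coe_symm_eq, Icc.coe_mul] at e
    have hs := mul_nonneg s.2.1 (sub_pos.mpr hlt).le
    have ht := mul_nonneg t.2.1 hpos.le
    constructor
    · refine Subtype.ext (mul_right_cancel₀ (sub_pos.mpr hlt).ne' ?_)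
      rw [Icc.coe_zero, zero_mul]
      nlinarith
    · refine Subtype.ext (mul_right_cancel₀ hpos.ne' ?_)
      rw [Icc.coe_zero, zero_mul]
      nlinarith
  obtain ⟨a, ha, ha'⟩ := exists_initial_direction h hα hαi (hα0 ▸ hx)
  obtain ⟨b, hb, hb'⟩ := exists_initial_direction h hβ hβi (hβ0 ▸ hx)
  refine not_same_direction h hα hβ (hα0.trans hβ0.symm) (hα0 ▸ hx) hmeet ha hb one_ne_zero ?_ ?_
  · rw [one_mul, one_mul]
    exact ha'.resolve_right (not_lt.mpr (by simpa [hα0] using hmax _ (hα0 ▸ ha a le_rfl)))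
  · rw [one_mul, one_mul]
    exact hb'.resolve_right (not_lt.mpr (by simpa [hβ0] using hmax _ (hβ0 ▸ hb b le_rfl)))

end Legs

/-! ### The apex is the only ramification point. -/

section Ramification

variable {r ρ : ℝ}

/-- The three legs of the model triod, parametrised from the top. -/
def triodLeg (k : Fin 3) (t : I) : triod :=
  ⟨![(-(t : ℝ), 0), ((t : ℝ), 0), (0, (t : ℝ))] k, by
    have h0 := t.2.1
    have h1 := t.2.2
    fin_cases k
    · exact Or.inl ⟨⟨neg_le_neg h1, by change -(t : ℝ) ≤ 1; linarith⟩, rfl⟩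
    · exact Or.inl ⟨⟨by change (-1 : ℝ) ≤ t; linarith, h1⟩, rfl⟩
    · exact Or.inr ⟨rfl, t.2⟩⟩

lemma continuous_triodLeg (k : Fin 3) : Continuous (triodLeg k) := by
  refine Continuous.subtype_mk ?_ _
  fin_cases k
  · exact Continuous.prodMk (by fun_prop) (by fun_prop)
  · exact Continuous.prodMk (by fun_prop) (by fun_prop)
  · exact Continuous.prodMk (by fun_prop) (by fun_prop)

lemma coe_triodLeg_zero (k : Fin 3) : (triodLeg k 0 : ℝ × ℝ) = (0, 0) := by
  fin_cases k <;> simp [triodLeg]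

lemma triodLeg_injective (k : Fin 3) : Function.Injective (triodLeg k) := fun s t hst => by
  have e := congrArg Subtype.val hst
  fin_cases k <;> simpa [triodLeg, Subtype.ext_iff] using e

lemma triodLeg_meet {k l : Fin 3} (hkl : k ≠ l) {s t : I} (hst : triodLeg k s = triodLeg l t) :
    s = 0 ∧ t = 0 := by
  have e := congrArg Subtype.val hst
  have hs := s.2.1
  have ht := t.2.1
  rw [Subtype.ext_iff, Subtype.ext_iff, Icc.coe_zero]
  have e1 := congrArg Prod.fst e
  have e2 := congrArg Prod.snd e
  fin_cases k <;> fin_cases l <;> first | exact absurd rfl hkl | skip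
  all_goals
    simp only [triodLeg, Fin.zero_eta, Fin.mk_one, Fin.reduceFinMk, Matrix.cons_val] at e1 e2
    constructor <;> linarith

/-- Off the apex a ray offers only two directions, so two of the three legs of a triod share one.
The Boolean `b` records the direction, `true` for down. -/
lemma eq_apex_of_mem_ramificationPoints (h : NeverConnect r ρ) {x : MLim r ρ}
    (hx : x ∈ ramificationPoints (MLim r ρ)) : x = apex r ρ := by
  by_contra hne
  obtain ⟨T, φ, o, ho, rfl⟩ := hx
  set α : Fin 3 → I → MLim r ρ := fun k t => (φ (triodLeg k t) : MLim r ρ)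
  have hα : ∀ k, Continuous (α k) := fun k =>
    continuous_subtype_val.comp (φ.continuous.comp (continuous_triodLeg k))
  have hinj : Function.Injective fun q => (φ q : MLim r ρ) :=
    Subtype.val_injective.comp φ.injective
  have hα0 : ∀ k, α k 0 = φ o := fun k => by
    rw [show o = triodLeg k 0 from Subtype.ext (ho.trans (coe_triodLeg_zero k).symm)]
  have key : ∀ k, ∃ a : I, ∃ b : Bool, (∀ t ≤ a, SameRay (α k 0) (α k t)) ∧
      (cond b 1 (-1) : ℝ) * coord (α k a) 0 < (cond b 1 (-1) : ℝ) * coord (α k 0) 0 := fun k => by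
    obtain ⟨a, ha, ha' | ha'⟩ := exists_initial_direction h (hα k)
      (hinj.comp (triodLeg_injective k)) (by rw [hα0]; exact hne)
    · exact ⟨a, true, ha, by simpa using ha'⟩
    · exact ⟨a, false, ha, by simpa using ha'⟩
  choose a b ha hb using key
  obtain ⟨k, l, hkl, hbkl⟩ := Fintype.exists_ne_map_eq_of_card_lt b (by simp)
  refine not_same_direction h (hα k) (hα l) ((hα0 k).trans (hα0 l).symm) (by rw [hα0]; exact hne)
    (fun s t hst => triodLeg_meet hkl (hinj hst)) (ha k) (ha l) (c := cond (b k) 1 (-1)) ?_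
    (hb k) (hbkl ▸ hb l)
  cases b k <;> simp

/-- The trajectory that increases up to time `k`, has value `1` at `k`, and decreases after. -/
noncomputable def peak (r ρ : ℝ) (k i : ℤ) : ℝ :=
  if i ≤ k then ρ ^ (i - k) else r ^ (i - k)

lemma peak_mem_trajectories (h : NeverConnect r ρ) (k : ℤ) : peak r ρ k ∈ trajectories r ρ := by
  obtain ⟨hr, hρ, hr1, hρ1, -⟩ := h
  refine ⟨fun i => ?_, fun i => ?_⟩
  · unfold peak
    split_ifs with hi
    · exact ⟨by positivity, zpow_le_one_of_nonpos₀ hρ1.le (by omega)⟩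
    · exact ⟨by positivity, zpow_le_one₀ hr hr1.le (by omega)⟩
  · unfold peak
    rcases lt_trichotomy i k with hi | rfl | hi
    · rw [if_pos (by omega), if_pos hi.le, show i + 1 - k = 1 + (i - k) by ring,
        zpow_add₀ hρ.ne', zpow_one]
      exact Or.inr rfl
    · rw [if_neg (by omega), if_pos le_rfl]
      simp
    · rw [if_neg (by omega), if_neg (by omega), show i + 1 - k = 1 + (i - k) by ring,
        zpow_add₀ hr.ne', zpow_one]
      exact Or.inl rfl

lemma peak_pos (h : NeverConnect r ρ) (k i : ℤ) : 0 < peak r ρ k i := by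
  obtain ⟨hr, hρ, -⟩ := h
  unfold peak
  split_ifs <;> positivity

lemma peak_self (r ρ : ℝ) (k : ℤ) : peak r ρ k k = 1 := by
  simp [peak]

/-- The end-point of `M` whose trajectory is `peak r ρ k`. -/
noncomputable def peakPoint (h : NeverConnect r ρ) (k : ℤ) : MLim r ρ :=
  ofTrajectory _ (peak_mem_trajectories h k)

lemma peakPoint_ne_apex (h : NeverConnect r ρ) (k : ℤ) : peakPoint h k ≠ apex r ρ := fun e => by
  have := congrArg (coord · k) e
  simp [peakPoint, peak_self] at this

/-- After time `k` the first trajectory is multiplied by `r`, while the second still grows by `ρ`.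
-/
lemma not_sameRay_peakPoint (h : NeverConnect r ρ) {k l : ℤ} (hkl : k < l) :
    ¬ SameRay (peakPoint h k) (peakPoint h l) := fun e => by
  have e1 := e.coord_eq h (peakPoint_ne_apex h k) (k + 1)
  have e0 := e.coord_eq h (peakPoint_ne_apex h k) k
  simp only [peakPoint, coord_ofTrajectory] at e0 e1
  have hl := peak_pos h l k
  have h1 : peak r ρ k (k + 1) = r * peak r ρ k k := by simp [peak]
  have h2 : peak r ρ l (k + 1) = ρ * peak r ρ l k := by
    rw [peak, peak, if_pos (by omega), if_pos hkl.le, show k + 1 - l = 1 + (k - l) by ring,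
      zpow_add₀ h.2.1.ne', zpow_one]
  rw [h1, h2, mul_left_comm, ← e0] at e1
  have := mul_right_cancel₀ hl.ne' e1
  linarith [h.2.2.1, h.2.2.2.1]

lemma compactSpace_triod : CompactSpace triod :=
  isCompact_iff_compactSpace.mp
    ((isCompact_Icc.prod isCompact_singleton).union (isCompact_singleton.prod isCompact_Icc))

/-- The parameters on the three legs of a point of the model triod. -/
noncomputable def legParams (q : triod) : Fin 3 → I :=
  ![projIcc 0 1 zero_le_one (-(q : ℝ × ℝ).1), projIcc 0 1 zero_le_one (q : ℝ × ℝ).1,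
    projIcc 0 1 zero_le_one (q : ℝ × ℝ).2]

lemma legParams_eq_zero_or (q : triod) (i j : Fin 3) (hij : i ≠ j) :
    legParams q i = 0 ∨ legParams q j = 0 := by
  obtain ⟨⟨u, v⟩, hq⟩ := q
  have h01 := projIcc_eq_zero_or_neg u
  have h2 : projIcc 0 1 zero_le_one v = (0 : I) ∨
      projIcc 0 1 zero_le_one (-u) = (0 : I) ∧ projIcc 0 1 zero_le_one u = (0 : I) := by
    rcases hq with hq | hq
    · exact Or.inl (by rw [show v = 0 from hq.2]; exact projIcc_left _)
    · rw [show u = 0 from hq.1, neg_zero]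
      exact Or.inr ⟨projIcc_left _, projIcc_left _⟩
  fin_cases i <;> fin_cases j <;> first | exact absurd rfl hij | skip
  all_goals simp only [legParams, Fin.zero_eta, Fin.mk_one, Fin.reduceFinMk, Matrix.cons_val]
  all_goals tauto

lemma legParams_injective : Function.Injective legParams := by
  rintro ⟨⟨u, v⟩, hq⟩ ⟨⟨u', v'⟩, hq'⟩ e
  have e0 : projIcc 0 1 zero_le_one (-u) = projIcc 0 1 zero_le_one (-u') := congrFun e 0
  have e1 : projIcc 0 1 zero_le_one u = projIcc 0 1 zero_le_one u' := congrFun e 1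
  have e2 : projIcc 0 1 zero_le_one v = projIcc 0 1 zero_le_one v' := congrFun e 2
  have mem : ∀ {u v : ℝ}, (u, v) ∈ triod → u ∈ Icc (-1 : ℝ) 1 ∧ v ∈ Icc (0 : ℝ) 1 := by
    rintro u v (⟨h1, h2⟩ | ⟨h1, h2⟩)
    · exact ⟨h1, by rw [show v = 0 from h2]; simp⟩
    · exact ⟨by rw [show u = 0 from h1]; simp, h2⟩
  have hu := projIcc_sub_projIcc_neg (mem hq).1
  have hu' := projIcc_sub_projIcc_neg (mem hq').1
  rw [e0, e1, hu'] at hu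
  rw [projIcc_of_mem _ (mem hq).2, projIcc_of_mem _ (mem hq').2] at e2
  exact Subtype.ext (Prod.ext hu.symm (congrArg Subtype.val e2))

lemma continuous_legParams (k : Fin 3) : Continuous fun q => legParams q k := by
  have hp : Continuous (projIcc (0 : ℝ) 1 zero_le_one) :=
    continuous_projIcc (h := zero_le_one)
  fin_cases k
  · exact hp.comp (by fun_prop)
  · exact hp.comp (by fun_prop)
  · exact hp.comp (by fun_prop)

/-- Three peak points on distinct rays span a triod with the apex as its top. -/
lemma apex_mem_ramificationPoints (h : NeverConnect r ρ) :
    apex r ρ ∈ ramificationPoints (MLim r ρ) := by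
  set a : Fin 3 → MLim r ρ := fun k => peakPoint h k
  set f : triod → MLim r ρ := fun q => spider a (legParams q) (legParams_eq_zero_or q)
  have hf : Continuous f := continuous_spider a legParams_eq_zero_or continuous_legParams
  have hinj : Function.Injective f := fun q q' hqq => legParams_injective <|
    spider_injective h (fun i j hij => by
      rcases lt_or_gt_of_ne hij with hlt | hlt
      · exact not_sameRay_peakPoint h (by simpa using hlt)
      · exact fun e => not_sameRay_peakPoint h (by simpa using hlt) e.symm)
      (fun i => peakPoint_ne_apex h _) (legParams_eq_zero_or q) (legParams_eq_zero_or q') hqq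
  have := compactSpace_triod
  refine ⟨range f, (hf.isClosedEmbedding hinj).isEmbedding.toHomeomorph, triodLeg 0 0,
    coe_triodLeg_zero 0, ?_⟩
  have h0 : ∀ k, legParams (triodLeg 0 0) k = 0 := fun k => by
    fin_cases k <;> simp [legParams, triodLeg]
  change f (triodLeg 0 0) = _
  dsimp only [f]
  rw [spider_eq_scale _ _ (j := 0) fun i _ => h0 i, h0, scale_zero]

lemma isFan_MLim (h : NeverConnect r ρ) : IsFan (MLim r ρ) :=
  ⟨isDendroid_MLim h, fun _ hx _ hy => (eq_apex_of_mem_ramificationPoints h hx).trans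
    (eq_apex_of_mem_ramificationPoints h hy).symm⟩

end Ramification

/-! ### Uniqueness of segments and smoothness. -/

section Smooth

variable {r ρ : ℝ}

/-- Pulled back to `[0,1]`, `C` is an order-connected set containing `0` and `1`. -/
lemma IsArcBetween.subset_of_isPreconnected {X : Type*} [TopologicalSpace X] [T2Space X]
    {A C : Set X} {x y : X} (hA : IsArcBetween A x y) (hC : IsPreconnected C) (hCA : C ⊆ A)
    (hx : x ∈ C) (hy : y ∈ C) : A ⊆ C := by
  obtain ⟨φ, rfl, rfl⟩ := hA
  set ψ : I → X := fun t => (φ t : X)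
  have hψ : Continuous ψ := by fun_prop
  have hψi : Function.Injective ψ := Subtype.val_injective.comp φ.injective
  have hpre : IsPreconnected (ψ ⁻¹' C) := hC.preimage_of_isClosedMap hψi hψ.isClosedMap
    fun z hz => ⟨φ.symm ⟨z, hCA hz⟩, by simp [ψ]⟩
  intro z hz
  have := hpre.ordConnected.out hx hy (show φ.symm ⟨z, hz⟩ ∈ Icc 0 1 from ⟨bot_le, le_top⟩)
  simpa [ψ] using this

lemma IsArcBetween.isCompact {X : Type*} [TopologicalSpace X] {A : Set X} {x y : X}
    (hA : IsArcBetween A x y) : IsCompact A := by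
  obtain ⟨φ, -, -⟩ := hA
  exact isCompact_iff_compactSpace.mpr φ.compactSpace

lemma IsArcBetween.isPreconnected {X : Type*} [TopologicalSpace X] {A : Set X} {x y : X}
    (hA : IsArcBetween A x y) : IsPreconnected A := by
  obtain ⟨φ, -, -⟩ := hA
  have := isPreconnected_range (continuous_subtype_val.comp φ.continuous)
  rwa [φ.surjective.range_comp, Subtype.range_val] at this

lemma IsSegment.eq_range_scale (h : NeverConnect r ρ) {A : Set (MLim r ρ)} {x : MLim r ρ}
    (hA : IsSegment A (apex r ρ) x) : A = range (scale x) := by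
  rcases hA with ⟨-, hA⟩ | ⟨rfl, rfl⟩
  · have h0 : apex r ρ ∈ A ∧ x ∈ A := by
      obtain ⟨φ, h0, h1⟩ := hA
      exact ⟨h0 ▸ (φ 0).2, h1 ▸ (φ 1).2⟩
    have hsub : range (scale x) ⊆ A := range_subset_iff.mpr
      (scale_mem h hA.isCompact.isClosed hA.isPreconnected h0.1 h0.2)
    refine (hA.subset_of_isPreconnected ?_ hsub ⟨0, scale_zero x⟩ ⟨1, scale_one x⟩).antisymm hsub
    exact isPreconnected_range (continuous_scale_right x)
  · have : scale (apex r ρ) = fun _ => apex r ρ :=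
      funext fun t => coord_injective (funext fun i => by simp)
    rw [this, range_const]

/-- The segment to `x` is the image of `I` under `scale x`; by joint continuity of `scale` this
image depends continuously on `x` in the Vietoris topology. -/
lemma isSmoothFan_MLim (h : NeverConnect r ρ) : IsSmoothFan (MLim r ρ) := by
  refine ⟨isFan_MLim h, apex r ρ, apex_mem_ramificationPoints h, fun x u hu A B hA hB => ?_⟩
  have hc : Continuous fun x : MLim r ρ => (⊤ : TopologicalSpace.NonemptyCompacts I).map (scale x)
      (continuous_scale_right x) :=
    continuous_const.nonemptyCompacts_map' continuous_scale
  have key : ∀ (x : MLim r ρ) (A : TopologicalSpace.NonemptyCompacts (MLim r ρ)),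
      IsSegment (A : Set (MLim r ρ)) (apex r ρ) x →
        A = (⊤ : TopologicalSpace.NonemptyCompacts I).map (scale x)
          (continuous_scale_right x) := fun x A hA =>
    SetLike.coe_injective (by
      rw [hA.eq_range_scale h, TopologicalSpace.NonemptyCompacts.coe_map,
        TopologicalSpace.NonemptyCompacts.coe_top, image_univ])
  rw [key x A hA, show B = _ from funext fun n => key _ _ (hB n)]
  exact (hc.tendsto x).comp hu

end Smooth

variable {r ρ : ℝ}

/-! ### The shift as a translation of time. -/

section Shift

/-- Time runs backwards: dropping the first term of the inverse limit exposes one earlier term of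
the trajectory. -/
lemma coord_sigmaLim (x : MLim r ρ) (i : ℤ) : coord (sigmaLim r ρ x) i = coord x (i - 1) := by
  obtain ⟨n, k, rfl⟩ : ∃ n k : ℕ, i = k - n := ⟨(-i).toNat, i.toNat, by omega⟩
  rw [show (k : ℤ) - n - 1 = (k : ℤ) - (n + 1 : ℕ) by push_cast; ring, ← coe_val_eq_coord,
    ← coe_val_eq_coord]
  rfl

lemma coord_add_mem_trajectories (x : MLim r ρ) (n : ℤ) :
    (fun i => coord x (i + n)) ∈ trajectories r ρ :=
  ⟨fun i => (coord_mem_trajectories x).1 (i + n), fun i => by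
    dsimp only
    rw [add_right_comm]
    exact coord_add_one x (i + n)⟩

/-- Translation of trajectories. -/
def translate (n : ℤ) (x : MLim r ρ) : MLim r ρ :=
  ofTrajectory _ (coord_add_mem_trajectories x n)

lemma coord_translate (n : ℤ) (x : MLim r ρ) (i : ℤ) : coord (translate n x) i = coord x (i + n) := by
  rw [translate, coord_ofTrajectory]

lemma continuous_translate (n : ℤ) : Continuous (translate n : MLim r ρ → MLim r ρ) :=
  continuous_ofTrajectory (fun x => coord_add_mem_trajectories x n) fun i => by fun_prop

lemma translate_translate (m n : ℤ) (x : MLim r ρ) :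
    translate m (translate n x) = translate (m + n) x :=
  coord_injective (funext fun i => by
    rw [coord_translate, coord_translate, coord_translate, add_assoc])

lemma translate_zero (x : MLim r ρ) : translate 0 x = x :=
  coord_injective (funext fun i => by rw [coord_translate, add_zero])

lemma sigmaLim_eq_translate : sigmaLim r ρ = translate (-1) :=
  funext fun x => coord_injective (funext fun i => by
    rw [coord_translate, coord_sigmaLim, sub_eq_add_neg])

lemma iterate_sigmaLim (n : ℕ) (x : MLim r ρ) : (sigmaLim r ρ)^[n] x = translate (-n) x := by
  induction n with
  | zero => simp [translate_zero]
  | succ n ih =>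
    rw [Function.iterate_succ_apply', ih, sigmaLim_eq_translate, translate_translate]
    congr 1
    push_cast
    ring

lemma isHomeomorph_sigmaLim (r ρ : ℝ) : IsHomeomorph (sigmaLim r ρ) := by
  rw [sigmaLim_eq_translate]
  exact Homeomorph.isHomeomorph
    { toFun := translate (-1)
      invFun := translate 1
      left_inv := fun x => by rw [translate_translate, add_neg_cancel, translate_zero]
      right_inv := fun x => by rw [translate_translate, neg_add_cancel, translate_zero]
      continuous_toFun := continuous_translate _
      continuous_invFun := continuous_translate _ }

end Shift

/-! ### Density of the products of powers. -/

section Density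

/-- This is where the arithmetic condition on `r` and `ρ` enters. -/
lemma NeverConnect.irrational (h : NeverConnect r ρ) : Irrational (Real.log r / Real.log ρ) := by
  obtain ⟨hr, hρ, hr1, hρ1, hkl⟩ := h
  have hp : 0 < Real.log ρ := Real.log_pos hρ1
  rintro ⟨q, hq⟩
  have hq' : (q.den : ℝ) * Real.log r = q.num * Real.log ρ := by
    rw [eq_div_iff hp.ne', ← Rat.num_div_den q] at hq
    push_cast at hq
    have : (q.den : ℝ) ≠ 0 := by exact_mod_cast q.den_ne_zero
    field_simp at hq
    linarith
  have e : r ^ (q.den : ℤ) = ρ ^ q.num := by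
    refine Real.log_injOn_pos (mem_Ioi.mpr (by positivity)) (mem_Ioi.mpr (by positivity)) ?_
    rw [Real.log_zpow, Real.log_zpow]
    exact_mod_cast hq'
  have := ((hkl _ _).mp e).1
  exact q.den_ne_zero (by exact_mod_cast this)

/-- The products `r ^ k * ρ ^ l` with natural exponents are dense in `(0, ∞)`. -/
lemma NeverConnect.exists_pow_mul_pow_mem_Ioo (h : NeverConnect r ρ) {s t : ℝ} (hs : 0 < s)
    (hst : s < t) : ∃ k l : ℕ, r ^ k * ρ ^ l ∈ Ioo s t := by
  have hirr := h.irrational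
  obtain ⟨hr, hρ, hr1, hρ1, -⟩ := h
  have hp : 0 < Real.log ρ := Real.log_pos hρ1
  have ha : Real.log r < 0 := Real.log_neg hr hr1
  have : Fact (0 < Real.log ρ) := ⟨hp⟩
  -- The natural multiples of `log r` are dense modulo `log ρ`.
  have hd := QuotientAddGroup.dense_preimage_mk.mpr
    (denseRange_zsmul_iff_nsmul.mp (AddCircle.denseRange_zsmul_coe_iff.mpr hirr))
  -- Reserving `N` factors `r` shifts the target interval into the positive reals, which forces the
  -- exponent `m` of `ρ` to be non-negative.
  obtain ⟨N, hN⟩ : ∃ N : ℕ, -Real.log s / (-Real.log r) < N := exists_nat_gt _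
  rw [div_lt_iff₀ (by linarith)] at hN
  obtain ⟨x, ⟨n, hn⟩, hx1, hx2⟩ := hd.exists_between
    (show Real.log s - N * Real.log r < Real.log t - N * Real.log r by
      linarith [Real.log_lt_log hs hst])
  have hn' : ((n • Real.log r : ℝ) : AddCircle (Real.log ρ)) = (x : AddCircle (Real.log ρ)) := hn
  obtain ⟨m, hm⟩ := AddCircle.coe_eq_zero_iff (Real.log ρ) |>.mp
    (show ((x - n • Real.log r : ℝ) : AddCircle (Real.log ρ)) = 0 by
      rw [AddCircle.coe_sub, hn', sub_self])
  rw [nsmul_eq_mul, zsmul_eq_mul] at hm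
  have hm0 : 0 ≤ m := by
    have h1 : (n : ℝ) * Real.log r ≤ 0 := mul_nonpos_of_nonneg_of_nonpos n.cast_nonneg ha.le
    have h2 : (0 : ℝ) < m * Real.log ρ := by linarith
    have h3 : (0 : ℝ) < m := pos_of_mul_pos_left h2 hp.le
    exact_mod_cast h3.le
  lift m to ℕ using hm0
  have hlog : Real.log (r ^ (n + N) * ρ ^ m) = x + N * Real.log r := by
    rw [Real.log_mul (by positivity) (by positivity), Real.log_pow, Real.log_pow]
    push_cast at hm ⊢
    linarith
  refine ⟨n + N, m, ?_, ?_⟩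
  · rw [← Real.log_lt_log_iff hs (by positivity), hlog]
    linarith
  · rw [← Real.log_lt_log_iff (by positivity) (hs.trans hst), hlog]
    linarith

end Density

/-! ### Gluing trajectories: transitivity and density of the end-points. -/

section Gluing

/-- `z` restricted to the set `S` of times is a trajectory. -/
def IsTrajectoryOn (r ρ : ℝ) (S : Set ℤ) (z : ℤ → ℝ) : Prop :=
  ∀ i ∈ S, z i ∈ Icc (0 : ℝ) 1 ∧ (i + 1 ∈ S → z (i + 1) = r * z i ∨ z (i + 1) = ρ * z i)

lemma isTrajectoryOn_univ_iff {z : ℤ → ℝ} : IsTrajectoryOn r ρ univ z ↔ z ∈ trajectories r ρ :=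
  ⟨fun hz => ⟨fun i => (hz i trivial).1, fun i => (hz i trivial).2 trivial⟩,
    fun hz i _ => ⟨hz.1 i, fun _ => hz.2 i⟩⟩

/-- The sequence that is `a` up to time `p` and `b` after. -/
def glue (p : ℤ) (a b : ℤ → ℝ) (i : ℤ) : ℝ :=
  if i ≤ p then a i else b i

lemma glue_of_le {p i : ℤ} {a b : ℤ → ℝ} (hi : i ≤ p) : glue p a b i = a i :=
  if_pos hi

lemma glue_of_ge {p i : ℤ} {a b : ℤ → ℝ} (hab : a p = b p) (hi : p ≤ i) : glue p a b i = b i := by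
  rcases hi.eq_or_lt with rfl | hi
  · rw [glue_of_le le_rfl, hab]
  · exact if_neg hi.not_ge

lemma IsTrajectoryOn.glue {S T U : Set ℤ} {p : ℤ} {a b : ℤ → ℝ} (ha : IsTrajectoryOn r ρ S a)
    (hb : IsTrajectoryOn r ρ T b) (hab : a p = b p) (hS : U ∩ Iic p ⊆ S) (hT : U ∩ Ici p ⊆ T) :
    IsTrajectoryOn r ρ U (glue p a b) := by
  intro i hi
  rcases lt_or_ge i p with hip | hip
  · rw [glue_of_le hip.le, glue_of_le (show i + 1 ≤ p from hip)]
    exact ⟨(ha i (hS ⟨hi, hip.le⟩)).1, fun h' => (ha i (hS ⟨hi, hip.le⟩)).2 (hS ⟨h', hip⟩)⟩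
  · rw [glue_of_ge hab hip, glue_of_ge hab (by omega)]
    exact ⟨(hb i (hT ⟨hi, hip⟩)).1, fun h' =>
      (hb i (hT ⟨hi, hip⟩)).2 (hT ⟨h', mem_Ici.mpr (by omega)⟩)⟩

/-- Any trajectory can be followed, after some time, by a slightly scaled down copy of any other
one. -/
lemma exists_gluing (h : NeverConnect r ρ) {v u : MLim r ρ} (hv : v ≠ apex r ρ)
    (hu : u ≠ apex r ρ) (N : ℕ) {c : ℝ} (hc0 : 0 < c) (hc1 : c < 1) :
    ∃ z : MLim r ρ, ∃ n : ℕ, ∃ d ∈ Ioo c 1, (∀ i : ℤ, i ≤ N → coord z i = coord v i) ∧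
      ∀ i : ℤ, -N ≤ i → coord z (i + n) = d * coord u i := by
  have hv0 := coord_pos h hv N
  have hu0 := coord_pos h hu (-N)
  obtain ⟨k, l, hkl1, hkl2⟩ := h.exists_pow_mul_pow_mem_Ioo
    (s := c * (coord u (-N) / coord v N)) (t := coord u (-N) / coord v N) (by positivity)
    (mul_lt_of_lt_one_left (by positivity) hc1)
  obtain ⟨hr, hρ, hr1, hρ1, -⟩ := h
  rw [lt_div_iff₀ hv0] at hkl2
  rw [← mul_div_assoc, div_lt_iff₀ hv0] at hkl1
  set d : ℝ := r ^ k * ρ ^ l * coord v N / coord u (-N) with hd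
  have hd0 : d ∈ Ioo c 1 := ⟨(lt_div_iff₀ hu0).mpr hkl1, (div_lt_one hu0).mpr hkl2⟩
  -- After time `N`, `k` steps down by `r` and `l` steps up by `ρ` end at time `N + k + l`, where
  -- the copy of `u` is entered at its time `-N`. Going down first keeps the values at most `1`: the
  -- ascent peaks at its end, at `d * coord u (-N)`.
  set n : ℕ := 2 * N + k + l with hn
  set g₁ : ℤ → ℝ := fun i => coord v N * r ^ (i - N) with hg₁
  set g₂ : ℤ → ℝ := fun i => coord v N * r ^ k * ρ ^ (i - N - k) with hg₂
  set g₃ : ℤ → ℝ := fun i => d * coord u (i - n) with hg₃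
  have t₁ : IsTrajectoryOn r ρ (Ici N) g₁ := fun i hi => by
    have hi' : (N : ℤ) ≤ i := hi
    refine ⟨⟨by positivity, mul_le_one₀ (coord_le_one v N) (by positivity)
      (zpow_le_one₀ hr hr1.le (by omega))⟩, fun _ => Or.inl ?_⟩
    simp only [hg₁]
    rw [show i + 1 - N = 1 + (i - N) by ring, zpow_add₀ hr.ne', zpow_one]
    ring
  have t₂ : IsTrajectoryOn r ρ (Iic (N + k + l)) g₂ := fun i hi => by
    have hi' : i ≤ N + k + l := hi
    refine ⟨⟨by positivity, ?_⟩, fun _ => Or.inr ?_⟩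
    · have h1 : ρ ^ (i - N - k) ≤ ρ ^ l := by
        rw [← zpow_natCast]
        exact zpow_le_zpow_right₀ hρ1.le (by omega)
      calc coord v N * r ^ k * ρ ^ (i - N - k) ≤ coord v N * r ^ k * ρ ^ l := by gcongr
        _ = r ^ k * ρ ^ l * coord v N := by ring
        _ ≤ 1 := hkl2.le.trans (coord_le_one u _)
    · simp only [hg₂]
      rw [show i + 1 - N - k = 1 + (i - N - k) by ring, zpow_add₀ hρ.ne', zpow_one]
      ring
  have t₃ : IsTrajectoryOn r ρ univ g₃ := fun i _ => by
    refine ⟨⟨mul_nonneg (hc0.trans hd0.1).le (coord_nonneg u _),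
      mul_le_one₀ hd0.2.le (coord_nonneg u _) (coord_le_one u _)⟩, fun _ => ?_⟩
    simp only [hg₃]
    rw [show i + 1 - (n : ℤ) = i - n + 1 by ring]
    rcases coord_add_one u (i - n) with e | e <;> rw [e]
    · left; ring
    · right; ring
  have e₂ : g₂ (N + k + l) = g₃ (N + k + l) := by
    simp only [hg₂, hg₃]
    rw [show (N : ℤ) + k + l - n = -N by rw [hn]; push_cast; ring,
      show (N : ℤ) + k + l - N - k = (l : ℤ) by ring, zpow_natCast, hd]
    field_simp
  have e₁ : g₁ (N + k) = glue (N + k + l) g₂ g₃ (N + k) := by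
    rw [glue_of_le (by omega)]
    simp only [hg₁, hg₂]
    rw [show (N : ℤ) + k - N - k = 0 by ring, show (N : ℤ) + k - N = (k : ℤ) by ring, zpow_natCast,
      zpow_zero, mul_one]
  have e₀ : coord v N = glue (N + k) g₁ (glue (N + k + l) g₂ g₃) N := by
    rw [glue_of_le (by omega)]
    simp [hg₁]
  have t : IsTrajectoryOn r ρ univ (glue N (coord v) (glue (N + k) g₁ (glue (N + k + l) g₂ g₃))) := by
    refine (isTrajectoryOn_univ_iff.mpr (coord_mem_trajectories v)).glue (T := Ici N) ?_ e₀
      (subset_univ _) inter_subset_right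
    refine t₁.glue (T := univ) ?_ e₁ inter_subset_left (subset_univ _)
    exact t₂.glue t₃ e₂ inter_subset_right (subset_univ _)
  refine ⟨ofTrajectory _ (isTrajectoryOn_univ_iff.mp t), n, d, hd0, fun i hi => ?_, fun i hi => ?_⟩
  · rw [coord_ofTrajectory, glue_of_le hi]
  · rw [coord_ofTrajectory, glue_of_ge e₀ (by omega), glue_of_ge e₁ (by omega),
      glue_of_ge e₂ (by omega)]
    simp only [hg₃, add_sub_cancel_right]

lemma exists_ne_apex_mem (h : NeverConnect r ρ) {U : Set (MLim r ρ)} (hU : IsOpen U)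
    (hne : U.Nonempty) : ∃ u ∈ U, u ≠ apex r ρ := by
  obtain ⟨x, hx⟩ := hne
  by_cases hx0 : x = apex r ρ
  · subst hx0
    obtain ⟨N, ε, hε, hN⟩ := exists_window_of_mem_nhds (hU.mem_nhds hx)
    have hm : 0 < min (ε / 2) 1 := by positivity
    set t : I := ⟨min (ε / 2) 1, hm.le, min_le_right _ _⟩ with ht
    refine ⟨scale (peakPoint h 0) t, hN _ fun i _ => ?_, fun e => ?_⟩
    · rw [coord_apex, sub_zero, abs_of_nonneg (coord_nonneg _ _), coord_scale]
      have h1 : (t : ℝ) ≤ ε / 2 := min_le_left _ _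
      have h2 := mul_le_mul_of_nonneg_left (coord_le_one (peakPoint h 0) i) t.2.1
      linarith
    · rw [scale_eq_apex_iff h (peakPoint_ne_apex h 0)] at e
      exact hm.ne' (congrArg Subtype.val e)
  · exact ⟨x, hx, hx0⟩

/-- Since `σ` translates by `-1`, the glued trajectory follows `v` first and `u` later: its
translate by `n` is in `U`, and `σ^n` brings that back into `V`. -/
lemma isTransitiveMap_sigmaLim (h : NeverConnect r ρ) : IsTransitiveMap (sigmaLim r ρ) := by
  intro U V hU hV hUne hVne
  obtain ⟨u, huU, hu⟩ := exists_ne_apex_mem h hU hUne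
  obtain ⟨v, hvV, hv⟩ := exists_ne_apex_mem h hV hVne
  obtain ⟨N₁, ε₁, hε₁, hN₁⟩ := exists_window_of_mem_nhds (hU.mem_nhds huU)
  obtain ⟨N₂, ε₂, hε₂, hN₂⟩ := exists_window_of_mem_nhds (hV.mem_nhds hvV)
  obtain ⟨z, n, d, hd, hz₁, hz₂⟩ := exists_gluing h hv hu (max N₁ N₂) (c := max (1 - ε₁) (1 / 2))
    (by positivity) (max_lt (by linarith) (by norm_num))
  refine ⟨n, z, ⟨translate n z, hN₁ _ fun i hi => ?_, ?_⟩, hN₂ _ fun i hi => ?_⟩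
  · have h1 : 1 - ε₁ < d := (le_max_left _ _).trans_lt hd.1
    rw [coord_translate, hz₂ i (by rw [abs_le] at hi; push_cast; omega),
      show d * coord u i - coord u i = -((1 - d) * coord u i) by ring, abs_neg,
      abs_of_nonneg (mul_nonneg (by linarith [hd.2]) (coord_nonneg u i))]
    have h2 := mul_le_mul_of_nonneg_left (coord_le_one u i) (show 0 ≤ 1 - d by linarith [hd.2])
    linarith
  · rw [iterate_sigmaLim, translate_translate, neg_add_cancel, translate_zero]
  · rw [hz₁ i (by rw [abs_le] at hi; push_cast; omega), sub_self, abs_zero]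
    exact hε₂

lemma dense_endPoints (h : NeverConnect r ρ) : Dense (endPoints (MLim r ρ)) := by
  rw [dense_iff_inter_open]
  intro U hU hUne
  obtain ⟨y, hyU, hy⟩ := exists_ne_apex_mem h hU hUne
  obtain ⟨N, ε, hε, hN⟩ := exists_window_of_mem_nhds (hU.mem_nhds hyU)
  -- A supremum `m` above `1 / (1 + ε)` gives `1 / m - 1 < ε`, so dividing by `m` changes values in
  -- `[0,1]` by less than `ε`.
  have hc1 : 1 / (1 + ε) < 1 := by
    rw [div_lt_one (by positivity)]
    linarith
  obtain ⟨z, n, d, hd, hz₁, hz₂⟩ := exists_gluing h hy (peakPoint_ne_apex h 0) N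
    (c := 1 / (1 + ε)) (by positivity) hc1
  have hbdd : BddAbove (range (coord z)) := ⟨1, by
    rintro _ ⟨i, rfl⟩
    exact coord_le_one z i⟩
  set m : ℝ := sSup (range (coord z)) with hm
  have hle : ∀ i, coord z i ≤ m := fun i => le_csSup hbdd ⟨i, rfl⟩
  have hm1 : m ≤ 1 := csSup_le (range_nonempty _) (by
    rintro _ ⟨i, rfl⟩
    exact coord_le_one z i)
  have hcm : 1 / (1 + ε) < m := by
    have h1 := hz₂ 0 (by omega)
    rw [peakPoint, coord_ofTrajectory, peak_self, mul_one] at h1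
    exact (hd.1.trans_eq h1.symm).trans_le (hle _)
  have hm0 : 0 < m := lt_trans (by positivity) hcm
  have hz0 : ∀ i, 0 < coord z i := coord_pos h fun e => by
    have h1 := hz₁ 0 (by omega)
    rw [e, coord_apex] at h1
    exact (coord_pos h hy 0).ne h1
  have ht : (fun i => coord z i / m) ∈ trajectories r ρ := by
    refine ⟨fun i => ⟨div_nonneg (coord_nonneg z i) hm0.le, (div_le_one hm0).mpr (hle i)⟩,
      fun i => ?_⟩
    dsimp only
    rcases coord_add_one z i with e | e <;> rw [e]
    · left; ring
    · right; ring
  have hx0 : ofTrajectory _ ht ≠ apex r ρ := fun e => by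
    have h1 := congrArg (coord · 0) e
    simp only [coord_ofTrajectory, coord_apex] at h1
    exact (div_pos (hz0 0) hm0).ne' h1
  refine ⟨ofTrajectory _ ht, hN _ fun i hi => ?_, mem_endPoints_of_forall_le h hx0 fun w hw => ?_⟩
  · have hy1 := coord_le_one y i
    have hy0 := coord_nonneg y i
    rw [div_lt_iff₀ (by positivity)] at hcm
    rw [coord_ofTrajectory, hz₁ i (abs_le.mp hi).2,
      show coord y i / m - coord y i = coord y i * (1 - m) / m by field_simp,
      abs_of_nonneg (div_nonneg (mul_nonneg hy0 (by linarith)) hm0.le), div_lt_iff₀ hm0]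
    nlinarith
  · by_contra hlt
    rw [not_le] at hlt
    -- A higher point on the ray would be a multiple by `q > 1` still bounded by `1`, so `z` would
    -- stay below `m / q`, against the choice of `m` as supremum.
    set q : ℝ := coord w 0 / coord (ofTrajectory _ ht) 0 with hq
    have hq1 : 1 < q := (one_lt_div (coord_pos h hx0 0)).mpr hlt
    have hzq : ∀ i, coord z i ≤ m / q := fun i => by
      have h1 := hw.coord_eq h hx0 i
      have h2 := coord_le_one w i
      rw [h1, ← hq, coord_ofTrajectory] at h2
      rw [le_div_iff₀ (by linarith)]
      have h3 : q * (coord z i / m) * m ≤ 1 * m := mul_le_mul_of_nonneg_right h2 hm0.le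
      rw [mul_assoc, div_mul_cancel₀ _ hm0.ne'] at h3
      linarith
    have : m ≤ m / q := csSup_le (range_nonempty _) (by
      rintro _ ⟨i, rfl⟩
      exact hzq i)
    exact absurd (div_lt_self hm0 hq1) (not_lt.mpr this)

end Gluing

end LelekFan

theorem theorem4 (r ρ : ℝ) (h : LelekFan.NeverConnect r ρ) :
    LelekFan.IsLelekFan (LelekFan.MLim r ρ) ∧
      IsHomeomorph (LelekFan.sigmaLim r ρ) ∧
      LelekFan.IsTransitiveMap (LelekFan.sigmaLim r ρ) :=
  ⟨⟨LelekFan.isSmoothFan_MLim h, LelekFan.dense_endPoints h⟩,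
    LelekFan.isHomeomorph_sigmaLim r ρ, LelekFan.isTransitiveMap_sigmaLim h⟩
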